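/- For positive parameters and $x>0$ put $$\Phi(x)={}_2F_3\left[\begin{array}{c}a_1,a_2\\ b_1,b_2,b_3\end{array}\Big|\,-x^2\right]=\sum_{n=0}^\infty\frac{(a_1)_n(a_2)_n}{n!\,(b_1)_n(b_2)_n(b_3)_n}(-x^2)^n,$$ where $(\alpha)_0=1$ and $(\alpha)_n=\alpha(\alpha+1)\cdots(\alpha+n-1)$ for $n\ge 1$. Let $\xi_1\le\xi_2\le\xi_3$ be the ascending arrangement of $a_2,\ a_1+\tfrac12,\ 2a_1$, and $\eta_1\le\eta_2\le\eta_3$ that of $a_1,\ a_2+\tfrac12,\ 2a_2$. Put $$A_1=(\xi_1,\xi_2,\xi_3),\ A_2=(\xi_2,\xi_1,\xi_3),\ A_3=(\xi_1,\xi_3,\xi_2),\ A_4=(\xi_3,\xi_1,\xi_2),\ A_5=(\xi_2,\xi_3,\xi_1),\ A_6=(\xi_3,\xi_2,\xi_1),$$ and let $B_1,\dots,B_6$ be the points obtained in the same way from $(\eta_1,\eta_2,\eta_3)$. Let $\mathbf S[A_iA_jB_jB_i]$ be the union over $\lambda\in[0,1]$ of the closed line segments joining $(1-\lambda)A_i+\lambda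 B_i$ and $(1-\lambda)A_j+\lambda B_j$. Let $a_1,a_2>0$ satisfy $a_1<a_2\le\min(2a_1,\tfrac12)$ if $a_1<\tfrac12$, and $a_1<a_2\le 2a_1$ if $a_1\ge\tfrac12$. Let $\mathbf S$ be any one of the three quadrilaterals $$\mathbf S[A_5A_6B_6B_5],\quad \mathbf S[A_1A_3B_3B_1],\quad \mathbf S[A_2A_4B_4B_2].$$ If $(b_1,b_2,b_3)\in\mathbf S$, then $\Phi(x)\ge0$ for all $x>0$; and if moreover $(b_1,b_2,b_3)$ is not one of the four vertices $A_i,A_j,B_j,B_i$ of $\mathbf S=\mathbf S[A_iA_jB_jB_i]$, then $\Phi(x)>0$ for all $x>0$. -/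

import Mathlib

noncomputable section

namespace SideQuad

/-- Pochhammer's symbol `(α)_n = α (α + 1) ⋯ (α + n - 1)`. -/
def poch (α : ℝ) (n : ℕ) : ℝ := (ascPochhammer ℝ n).eval α

/-- The generalized hypergeometric function `ₚF_q[u; v | z]` with lists `u`, `v` of real numerator
and denominator parameters, at a real argument. -/
def pFq (u v : List ℝ) (z : ℝ) : ℝ :=
  ∑' n : ℕ, (u.map fun α => poch α n).prod /
    ((n.factorial : ℝ) * (v.map fun β => poch β n).prod) * z ^ n

/-- `Φ(x) = ₂F₃[a₁, a₂; b₁, b₂, b₃ | -x²]`, with `b = (b₁, b₂, b₃)`. -/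
def Phi (a₁ a₂ : ℝ) (b : Fin 3 → ℝ) (x : ℝ) : ℝ :=
  pFq [a₁, a₂] [b 0, b 1, b 2] (-x ^ 2)

/-- The ascending arrangement of three real numbers. -/
def ascending (p q r : ℝ) : Fin 3 → ℝ :=
  ![min p (min q r), p + q + r - min p (min q r) - max p (max q r), max p (max q r)]

theorem ascending_perm (p q r : ℝ) :
    [ascending p q r 0, ascending p q r 1, ascending p q r 2].Perm [p, q, r] := by
  rw [← Multiset.coe_eq_coe]
  simp only [← Multiset.cons_coe, Multiset.coe_nil, ← Multiset.singleton_add, add_zero,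
    ascending, Matrix.cons_val]
  rcases le_total p q with h | h <;> rcases le_total q r with h' | h' <;>
    rcases le_total p r with h'' | h'' <;>
    simp only [min_eq_left, min_eq_right, max_eq_left, max_eq_right, h, h', h''] <;>
    ring_nf <;>
    first
    | done
    | abel1
    | (obtain rfl : p = q := by linarith
       obtain rfl : p = r := by linarith
       ring_nf)

theorem ascending_mono (p q r : ℝ) : Monotone (ascending p q r) := by
  rw [Fin.monotone_iff_le_succ]
  intro i
  fin_cases i <;> simp [ascending] <;>
    rcases le_total p q with h | h <;> rcases le_total q r with h' | h' <;>
    rcases le_total p r with h'' | h'' <;> simp [*] <;> grind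

/-- The labels of the six permutations of a triple. -/
inductive Label
  | one | two | three | four | five | six

/-- The labelled permutations of the triple `(t 0, t 1, t 2)`. -/
def permuted (t : Fin 3 → ℝ) : Label → Fin 3 → ℝ
  | .one => ![t 0, t 1, t 2]
  | .two => ![t 1, t 0, t 2]
  | .three => ![t 0, t 2, t 1]
  | .four => ![t 2, t 0, t 1]
  | .five => ![t 1, t 2, t 0]
  | .six => ![t 2, t 1, t 0]

/-- The triple `(ξ₁, ξ₂, ξ₃)`. -/
def xi (a₁ a₂ : ℝ) : Fin 3 → ℝ := ascending a₂ (a₁ + 1 / 2) (2 * a₁)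

/-- The triple `(η₁, η₂, η₃)`. -/
def eta (a₁ a₂ : ℝ) : Fin 3 → ℝ := ascending a₁ (a₂ + 1 / 2) (2 * a₂)

/-- The points `A₁, …, A₆`. -/
def A (a₁ a₂ : ℝ) (i : Label) : Fin 3 → ℝ := permuted (xi a₁ a₂) i

/-- The points `B₁, …, B₆`. -/
def B (a₁ a₂ : ℝ) (i : Label) : Fin 3 → ℝ := permuted (eta a₁ a₂) i

/-- The side quadrilateral `S[AᵢAⱼBⱼBᵢ]`: the union over `0 ≤ lam ≤ 1` of the segments joining
`(1 - lam) Aᵢ + lam Bᵢ` and `(1 - lam) Aⱼ + lam Bⱼ`. -/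
def S (a₁ a₂ : ℝ) (i j : Label) : Set (Fin 3 → ℝ) :=
  ⋃ lam ∈ Set.Icc (0 : ℝ) 1,
    segment ℝ ((1 - lam) • A a₁ a₂ i + lam • B a₁ a₂ i)
      ((1 - lam) • A a₁ a₂ j + lam • B a₁ a₂ j)

/-- The set `Σ` of admissible pairs `(a₁, a₂)`. -/
def admissible : Set (ℝ × ℝ) :=
  {a | 0 < a.1 ∧ 0 < a.2 ∧
    (a.1 < 1 / 2 → a.1 < a.2 ∧ a.2 ≤ min (2 * a.1) (1 / 2)) ∧
    (1 / 2 ≤ a.1 → a.1 < a.2 ∧ a.2 ≤ 2 * a.1)}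

end SideQuad

end

/-!
For `0 < c` the function `₁F₂[c; c + 1/2, 2c | z]` is the square of the Bessel-type function
`₀F₁[; c + 1/2 | z / 4]`, hence nonnegative. The coefficients of `Φ` arise from its coefficients on
multiplying by `∏ᵢ (αᵢ)ₖ / (βᵢ)ₖ`, where `α = (a₁, a₂, c + 1/2, 2c)`, `β = (c, b₁, b₂, b₃)`. When
`∑ αᵢ = ∑ βᵢ`, Frullani's integral writes this product, up to a constant factor, as the exponential
of `k ↦ ∫ e^{-ks} dμ(s)`, where `μ` has density `(∑ e^{-αᵢ s} - ∑ e^{-βᵢ s}) / (s (1 - e^{-s}))` on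
`(0, ∞)`. If `μ` is positive, multiplying the coefficients of a function that is nonnegative on
`(-∞, 0]` by the moments amounts to averaging its dilations, and the exponential series then shows
that multiplying by the exponentials of the moments preserves nonnegativity too; the linear term
alone gives strict positivity when the density never vanishes.

It remains to choose `c` so that `∑ e^{-βᵢ s} ≤ ∑ e^{-αᵢ s}`. For `b` on the segment with
parameter `λ`, the choice is `c = (1 - λ) a₁ + λ a₂`: the exponential sum is convex and invariant
under permutations, so it suffices to treat `b = (1 - λ) ξ + λ η`, where the inequality expresses
the convexity of `u ↦ e^{-us}` or of `u ↦ e^{-us} - e^{-(u + 1/2)s}`.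
-/

namespace SideQuad

section Pochhammer

open Finset

theorem poch_zero (α : ℝ) : poch α 0 = 1 := by simp [poch]

theorem poch_succ (α : ℝ) (n : ℕ) : poch α (n + 1) = poch α n * (α + n) :=
  ascPochhammer_succ_eval n α

theorem poch_pos {α : ℝ} (hα : 0 < α) (n : ℕ) : 0 < poch α n := ascPochhammer_pos n α hα

theorem min_one_le_poch {α : ℝ} (hα : 0 < α) (n : ℕ) : min α 1 ≤ poch α n := by
  rcases n with _ | n
  · simp [poch_zero]
  refine (min_le_left α 1).trans ?_
  induction n with
  | zero => simp [poch_succ, poch_zero]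
  | succ n ih =>
    rw [poch_succ]
    refine ih.trans (le_mul_of_one_le_right (poch_pos hα _).le ?_)
    push_cast
    linarith [n.cast_nonneg (α := ℝ)]

theorem poch_add (α : ℝ) (n m : ℕ) : poch α (n + m) = poch α n * poch (α + n) m := by
  induction m with
  | zero => simp [poch_zero]
  | succ m ih => rw [← add_assoc, poch_succ, ih, poch_succ]; push_cast; ring

theorem poch_two_mul (α : ℝ) (n : ℕ) :
    poch (2 * α) (2 * n) = 4 ^ n * poch α n * poch (α + 1 / 2) n := by
  induction n with
  | zero => simp [poch_zero]
  | succ n ih =>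
    rw [show 2 * (n + 1) = 2 * n + 1 + 1 by ring, poch_succ, poch_succ, ih, poch_succ, poch_succ]
    push_cast
    ring

-- The Chu–Vandermonde identity for the falling factorials of `β + n - 1` and `α + n - 1`.
theorem poch_add_add_sub_one (α β : ℝ) (n : ℕ) :
    poch (α + β + n - 1) n =
      ∑ p ∈ antidiagonal n, n.choose p.1 * (poch (α + p.1) p.2 * poch (β + p.2) p.1) := by
  have h := Ring.descPochhammer_smeval_add (R := ℝ) n (Commute.all (β + n - 1) (α + n - 1))
  simp only [Polynomial.descPochhammer_smeval_eq_ascPochhammer,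
    Polynomial.ascPochhammer_smeval_eq_eval] at h
  convert h using 1
  · rw [poch]
    congr 1
    ring
  · refine sum_congr rfl fun p hp => ?_
    have hn : (n : ℝ) = p.1 + p.2 := by exact_mod_cast (mem_antidiagonal.1 hp).symm
    rw [mul_comm (poch _ _), poch, poch, hn, show β + (p.1 + p.2) - 1 - p.1 + 1 = β + p.2 by ring,
      show α + (p.1 + p.2) - 1 - p.2 + 1 = α + p.1 by ring]

end Pochhammer

section BesselSquare

open Finset

/-- The coefficient of `z ^ n` in `ₚF_q[u; v | z]`. -/
noncomputable def pFqCoeff (u v : List ℝ) (n : ℕ) : ℝ :=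
  (u.map fun α => poch α n).prod / (n.factorial * (v.map fun β => poch β n).prod)

theorem pFq_eq_tsum (u v : List ℝ) (z : ℝ) : pFq u v z = ∑' n, pFqCoeff u v n * z ^ n := rfl

theorem sum_antidiagonal_pFqCoeff_mul {α β : ℝ} (hα : 0 < α) (hβ : 0 < β) (n : ℕ) :
    ∑ p ∈ antidiagonal n, pFqCoeff [] [α] p.1 * pFqCoeff [] [β] p.2 =
      poch (α + β + n - 1) n / (n.factorial * (poch α n * poch β n)) := by
  rw [poch_add_add_sub_one, sum_div]
  refine sum_congr rfl fun p hp => ?_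
  obtain rfl : p.1 + p.2 = n := mem_antidiagonal.1 hp
  have hp₁ := (poch_pos hα p.1).ne'
  have hp₂ := (poch_pos hβ p.2).ne'
  have hq₁ := (poch_pos (show 0 < α + p.1 by positivity) p.2).ne'
  have hq₂ := (poch_pos (show 0 < β + p.2 by positivity) p.1).ne'
  have hchoose : ((p.1 + p.2).choose p.1 : ℝ) * p.1.factorial * p.2.factorial =
      (p.1 + p.2).factorial := by
    rw [Nat.choose_symm_add]
    exact_mod_cast Nat.add_choose_mul_factorial_mul_factorial p.1 p.2
  have hchoose₀ : ((p.1 + p.2).choose p.1 : ℝ) ≠ 0 :=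
    mod_cast (Nat.choose_pos (Nat.le_add_right p.1 p.2)).ne'
  rw [poch_add α, add_comm p.1 p.2, poch_add β, add_comm p.2 p.1, ← hchoose]
  simp only [pFqCoeff, List.map_nil, List.prod_nil, List.map_cons, List.prod_cons, mul_one]
  field_simp

theorem sum_antidiagonal_pFqCoeff_add_half {c : ℝ} (hc : 0 < c) (n : ℕ) :
    ∑ p ∈ antidiagonal n, pFqCoeff [] [c + 1 / 2] p.1 * pFqCoeff [] [c + 1 / 2] p.2 =
      4 ^ n * pFqCoeff [c] [c + 1 / 2, 2 * c] n := by
  have hc' : 0 < c + 1 / 2 := by positivity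
  have hpoch : poch (2 * c) n * poch (2 * c + n) n = 4 ^ n * poch c n * poch (c + 1 / 2) n := by
    rw [← poch_add, ← two_mul, poch_two_mul]
  have h₁ := (poch_pos hc' n).ne'
  have h₂ := (poch_pos (show 0 < 2 * c by positivity) n).ne'
  set d := c + 1 / 2
  rw [sum_antidiagonal_pFqCoeff_mul hc' hc',
    show d + d + n - 1 = 2 * c + n by ring]
  simp only [pFqCoeff, List.map_cons, List.map_nil, List.prod_cons, List.prod_nil, mul_one]
  field_simp
  linear_combination hpoch

theorem summable_norm_pFqCoeff_nil_singleton {β : ℝ} (hβ : 0 < β) (z : ℝ) :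
    Summable fun n => ‖pFqCoeff [] [β] n * z ^ n‖ := by
  refine ((Real.summable_pow_div_factorial |z|).mul_left (min β 1)⁻¹).of_nonneg_of_le
    (fun _ => norm_nonneg _) fun n => ?_
  have hpoch := poch_pos hβ n
  calc ‖pFqCoeff [] [β] n * z ^ n‖ = (poch β n)⁻¹ * (|z| ^ n / n.factorial) := by
        simp only [pFqCoeff, List.map_nil, List.prod_nil, List.map_cons, List.prod_cons, mul_one,
          norm_mul, norm_div, norm_one, norm_pow, Real.norm_eq_abs, Nat.abs_cast,
          abs_of_pos hpoch]
        field_simp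
    _ ≤ (min β 1)⁻¹ * (|z| ^ n / n.factorial) := by
        gcongr ?_ * _
        exact inv_anti₀ (lt_min hβ one_pos) (min_one_le_poch hβ n)

theorem sum_antidiagonal_pFqCoeff_mul_pow {c : ℝ} (hc : 0 < c) (z : ℝ) (n : ℕ) :
    ∑ p ∈ antidiagonal n, (pFqCoeff [] [c + 1 / 2] p.1 * (z / 4) ^ p.1) *
      (pFqCoeff [] [c + 1 / 2] p.2 * (z / 4) ^ p.2) =
        pFqCoeff [c] [c + 1 / 2, 2 * c] n * z ^ n := by
  calc _ = (∑ p ∈ antidiagonal n, pFqCoeff [] [c + 1 / 2] p.1 * pFqCoeff [] [c + 1 / 2] p.2) *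
        (z / 4) ^ n := by
        rw [sum_mul]
        refine sum_congr rfl fun p hp => ?_
        rw [← mem_antidiagonal.1 hp, pow_add]
        ring
    _ = _ := by
        rw [sum_antidiagonal_pFqCoeff_add_half hc, div_pow]
        field_simp

theorem summable_pFqCoeff_add_half {c : ℝ} (hc : 0 < c) (z : ℝ) :
    Summable fun n => pFqCoeff [c] [c + 1 / 2, 2 * c] n * z ^ n := by
  have h := summable_norm_pFqCoeff_nil_singleton (show 0 < c + 1 / 2 by positivity) (z / 4)
  exact (summable_norm_sum_mul_antidiagonal_of_summable_norm h h).of_norm.congr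
    (sum_antidiagonal_pFqCoeff_mul_pow hc z)

theorem pFq_add_half_eq_sq {c : ℝ} (hc : 0 < c) (z : ℝ) :
    pFq [c] [c + 1 / 2, 2 * c] z = pFq [] [c + 1 / 2] (z / 4) ^ 2 := by
  have h := summable_norm_pFqCoeff_nil_singleton (show 0 < c + 1 / 2 by positivity) (z / 4)
  rw [sq, pFq_eq_tsum, pFq_eq_tsum, tsum_mul_tsum_eq_tsum_sum_antidiagonal_of_summable_norm h h]
  exact (tsum_congr (sum_antidiagonal_pFqCoeff_mul_pow hc z)).symm

end BesselSquare

/-- The coefficient sequences of entire power series that are nonnegative on the half-line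
`(-∞, 0]`; these are the sequences on which the multipliers below act. -/
structure NonnegOnNonpos (f : ℕ → ℝ) : Prop where
  summable (x : ℝ) : Summable fun k => f k * x ^ k
  tsum_nonneg {x : ℝ} (hx : x ≤ 0) : 0 ≤ ∑' k, f k * x ^ k

theorem NonnegOnNonpos.const_mul {f : ℕ → ℝ} (hf : NonnegOnNonpos f) {C : ℝ} (hC : 0 ≤ C) :
    NonnegOnNonpos fun k => C * f k where
  summable x := ((hf.summable x).mul_left C).congr fun _ => (mul_assoc _ _ _).symm
  tsum_nonneg hx := by
    simp only [mul_assoc, tsum_mul_left]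
    exact mul_nonneg hC (hf.tsum_nonneg hx)

theorem nonnegOnNonpos_pFqCoeff_add_half {c : ℝ} (hc : 0 < c) :
    NonnegOnNonpos (pFqCoeff [c] [c + 1 / 2, 2 * c]) where
  summable := summable_pFqCoeff_add_half hc
  tsum_nonneg _ := by
    rw [← pFq_eq_tsum, pFq_add_half_eq_sq hc]
    exact sq_nonneg _

section Series

variable {f g q : ℕ → ℝ} {C : ℝ}

theorem summable_mul_of_abs_le (hf : Summable f) (hq : ∀ k, |q k| ≤ C) :
    Summable fun k => f k * q k :=
  (hf.norm.mul_left C).of_norm_bounded fun k => by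
    rw [norm_mul, mul_comm]
    exact mul_le_mul_of_nonneg_right (hq k) (norm_nonneg _)

theorem continuous_tsum_mul_pow (hf : ∀ x : ℝ, Summable fun k => f k * x ^ k) :
    Continuous fun x => ∑' k, f k * x ^ k := by
  refine continuous_iff_continuousAt.2 fun x => ?_
  have hcont : ContinuousOn (fun x => ∑' k, f k * x ^ k) (Metric.ball 0 (|x| + 1)) :=
    continuousOn_tsum (fun k => by fun_prop) (hf (|x| + 1)).norm fun k y hy => by
      rw [norm_mul, norm_mul, norm_pow, norm_pow]
      gcongr
      exact (mem_ball_zero_iff.1 hy).le.trans (le_abs_self _)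
  exact hcont.continuousAt (Metric.isOpen_ball.mem_nhds (by simp))

theorem hasSum_inv_factorial_mul_tsum_mul_pow (hg : Summable g) (hq : ∀ k, |q k| ≤ C) :
    HasSum (fun m : ℕ => (m.factorial : ℝ)⁻¹ * ∑' k, g k * q k ^ m)
      (∑' k, g k * Real.exp (q k)) := by
  have hC : 0 ≤ C := (abs_nonneg _).trans (hq 0)
  have hprod : Summable fun p : ℕ × ℕ => g p.1 * (q p.1 ^ p.2 / p.2.factorial) := by
    refine (hg.norm.mul_of_nonneg (Real.summable_pow_div_factorial C) (fun _ => norm_nonneg _)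
      fun m => by positivity).of_norm_bounded fun p => ?_
    rw [norm_mul, norm_div, norm_pow, Real.norm_natCast]
    gcongr
    exact hq p.1
  have hexp : ∑' p : ℕ × ℕ, g p.1 * (q p.1 ^ p.2 / p.2.factorial) =
      ∑' k, g k * Real.exp (q k) := by
    rw [hprod.tsum_prod]
    simp only [tsum_mul_left, Real.exp_eq_exp_ℝ, NormedSpace.exp_eq_tsum_div]
  have hswap : HasSum (fun p : ℕ × ℕ => g p.2 * (q p.2 ^ p.1 / p.1.factorial))
      (∑' k, g k * Real.exp (q k)) := by
    rw [← hexp]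
    exact (Equiv.prodComm ℕ ℕ).hasSum_iff.2 hprod.hasSum
  convert hswap.prod_fiberwise fun m => (hswap.summable.prod_factor m).hasSum using 2 with m
  rw [← tsum_mul_left]
  exact tsum_congr fun k => by ring

end Series

section Moments

open MeasureTheory ProbabilityTheory Set

variable {Ω : Type*} {mΩ : MeasurableSpace Ω} {μ : Measure Ω} {T : Ω → ℝ} {f : ℕ → ℝ}
  {x : ℝ}

theorem NonnegOnNonpos.ae_tsum_mul_pow_nonneg (hf : NonnegOnNonpos f)
    (hT₀₁ : ∀ᵐ ω ∂μ, T ω ∈ Icc 0 1) (hx : x ≤ 0) :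
    0 ≤ᵐ[μ] fun ω => ∑' k, f k * (x * T ω) ^ k := by
  filter_upwards [hT₀₁] with ω hω
  exact hf.tsum_nonneg (mul_nonpos_of_nonpos_of_nonneg hx hω.1)

variable [IsFiniteMeasure μ]

theorem integrable_pow_of_mem_Icc (hT : AEMeasurable T μ) (hT₀₁ : ∀ᵐ ω ∂μ, T ω ∈ Icc 0 1)
    (k : ℕ) : Integrable (fun ω => T ω ^ k) μ := by
  refine Integrable.of_bound (hT.pow_const k).aestronglyMeasurable 1 ?_
  filter_upwards [hT₀₁] with ω hω
  rw [Real.norm_of_nonneg (pow_nonneg hω.1 k)]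
  exact pow_le_one₀ hω.1 hω.2

theorem abs_moment_le_of_mem_Icc (hT₀₁ : ∀ᵐ ω ∂μ, T ω ∈ Icc 0 1) (k : ℕ) :
    |moment T k μ| ≤ μ.real univ := by
  have h : ‖∫ ω, T ω ^ k ∂μ‖ ≤ 1 * μ.real univ := by
    refine norm_integral_le_of_norm_le_const ?_
    filter_upwards [hT₀₁] with ω hω
    rw [Real.norm_of_nonneg (pow_nonneg hω.1 k)]
    exact pow_le_one₀ hω.1 hω.2
  rwa [one_mul] at h

theorem tsum_mul_moment (hT : AEMeasurable T μ) (hT₀₁ : ∀ᵐ ω ∂μ, T ω ∈ Icc 0 1)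
    (hf : Summable fun k => f k * x ^ k) :
    ∑' k, f k * moment T k μ * x ^ k = ∫ ω, ∑' k, f k * (x * T ω) ^ k ∂μ := by
  have hnorm (k : ℕ) : ∫ ω, ‖f k * x ^ k * T ω ^ k‖ ∂μ = |f k * x ^ k| * moment T k μ := by
    rw [moment_def, ← integral_const_mul]
    refine integral_congr_ae ?_
    filter_upwards [hT₀₁] with ω hω
    rw [norm_mul, Real.norm_of_nonneg (pow_nonneg hω.1 k), Real.norm_eq_abs, Pi.pow_apply]
  have hsum := hasSum_integral_of_summable_integral_norm
    (fun k => (integrable_pow_of_mem_Icc hT hT₀₁ k).const_mul (f k * x ^ k))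
    ((summable_mul_of_abs_le hf.abs (abs_moment_le_of_mem_Icc hT₀₁)).congr fun k => (hnorm k).symm)
  simp only [mul_pow, ← mul_assoc]
  rw [← hsum.tsum_eq]
  refine tsum_congr fun k => ?_
  rw [integral_const_mul, mul_right_comm, moment_def]
  rfl

theorem NonnegOnNonpos.mul_moment (hf : NonnegOnNonpos f) (hT : AEMeasurable T μ)
    (hT₀₁ : ∀ᵐ ω ∂μ, T ω ∈ Icc 0 1) : NonnegOnNonpos fun k => f k * moment T k μ where
  summable x := (summable_mul_of_abs_le (hf.summable x) (abs_moment_le_of_mem_Icc hT₀₁)).congr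
    fun _ => mul_right_comm _ _ _
  tsum_nonneg {x} hx := by
    rw [tsum_mul_moment hT hT₀₁ (hf.summable x)]
    exact integral_nonneg_of_ae (hf.ae_tsum_mul_pow_nonneg hT₀₁ hx)

theorem NonnegOnNonpos.tsum_mul_moment_pos (hf : NonnegOnNonpos f) (hf₀ : 0 < f 0)
    (hT : AEMeasurable T μ) (hT₀₁ : ∀ᵐ ω ∂μ, T ω ∈ Icc 0 1)
    (hT₀ : ∀ ε > 0, 0 < μ {ω | T ω ∈ Ico 0 ε}) (hx : x ≤ 0) :
    0 < ∑' k, f k * moment T k μ * x ^ k := by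
  set F : ℝ → ℝ := fun t => ∑' k, f k * (x * t) ^ k
  have hFcont : Continuous F :=
    (continuous_tsum_mul_pow hf.summable).comp (continuous_const_mul x)
  have hF₀ : F 0 = f 0 :=
    (tsum_eq_single 0 fun k hk => by simp [hk]).trans (by rw [pow_zero, mul_one])
  obtain ⟨ε, hε, hFε⟩ := Metric.eventually_nhds_iff.1
    (hFcont.continuousAt.eventually (lt_mem_nhds (hf₀.trans_eq hF₀.symm)))
  have hint : Integrable (fun ω => F (T ω)) μ := by
    obtain ⟨C, hC⟩ := isCompact_Icc.exists_bound_of_continuousOn (s := Icc (0 : ℝ) 1)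
      hFcont.continuousOn
    exact Integrable.of_bound (hFcont.measurable.comp_aemeasurable hT).aestronglyMeasurable C
      (hT₀₁.mono fun ω hω => hC _ hω)
  rw [tsum_mul_moment hT hT₀₁ (hf.summable x),
    integral_pos_iff_support_of_nonneg_ae (hf.ae_tsum_mul_pow_nonneg hT₀₁ hx) hint]
  refine (hT₀ ε hε).trans_le (measure_mono fun ω hω => (hFε ?_).ne')
  rw [Real.dist_0_eq_abs, abs_of_nonneg hω.1]
  exact hω.2

theorem NonnegOnNonpos.mul_moment_pow (hf : NonnegOnNonpos f) (hT : AEMeasurable T μ)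
    (hT₀₁ : ∀ᵐ ω ∂μ, T ω ∈ Icc 0 1) (m : ℕ) :
    NonnegOnNonpos fun k => f k * moment T k μ ^ m := by
  induction m with
  | zero => simpa only [pow_zero, mul_one] using hf
  | succ m ih => simpa only [pow_succ, mul_assoc] using ih.mul_moment hT hT₀₁

theorem NonnegOnNonpos.hasSum_mul_exp_moment (hf : NonnegOnNonpos f)
    (hT₀₁ : ∀ᵐ ω ∂μ, T ω ∈ Icc 0 1) (x : ℝ) :
    HasSum (fun m : ℕ => (m.factorial : ℝ)⁻¹ * ∑' k, f k * moment T k μ ^ m * x ^ k)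
      (∑' k, f k * Real.exp (moment T k μ) * x ^ k) := by
  simpa only [mul_right_comm] using
    hasSum_inv_factorial_mul_tsum_mul_pow (hf.summable x) (abs_moment_le_of_mem_Icc hT₀₁)

theorem NonnegOnNonpos.mul_exp_moment (hf : NonnegOnNonpos f) (hT : AEMeasurable T μ)
    (hT₀₁ : ∀ᵐ ω ∂μ, T ω ∈ Icc 0 1) :
    NonnegOnNonpos fun k => f k * Real.exp (moment T k μ) where
  summable x := by
    refine (summable_mul_of_abs_le (hf.summable x) (q := fun k => Real.exp (moment T k μ))
      (C := Real.exp (μ.real univ)) fun k => ?_).congr fun _ => mul_right_comm _ _ _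
    rw [Real.abs_exp, Real.exp_le_exp]
    exact (le_abs_self _).trans (abs_moment_le_of_mem_Icc hT₀₁ k)
  tsum_nonneg {x} hx := (hf.hasSum_mul_exp_moment hT₀₁ x).nonneg fun m =>
    mul_nonneg (by positivity) ((hf.mul_moment_pow hT hT₀₁ m).tsum_nonneg hx)

theorem NonnegOnNonpos.tsum_mul_exp_moment_pos (hf : NonnegOnNonpos f) (hf₀ : 0 < f 0)
    (hT : AEMeasurable T μ) (hT₀₁ : ∀ᵐ ω ∂μ, T ω ∈ Icc 0 1)
    (hT₀ : ∀ ε > 0, 0 < μ {ω | T ω ∈ Ico 0 ε}) (hx : x ≤ 0) :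
    0 < ∑' k, f k * Real.exp (moment T k μ) * x ^ k := by
  have hone : 0 < ((1 : ℕ).factorial : ℝ)⁻¹ * ∑' k, f k * moment T k μ ^ 1 * x ^ k := by
    simpa using hf.tsum_mul_moment_pos hf₀ hT hT₀₁ hT₀ hx
  exact hone.trans_le (le_hasSum (hf.hasSum_mul_exp_moment hT₀₁ x) 1 fun m _ =>
    mul_nonneg (by positivity) ((hf.mul_moment_pow hT hT₀₁ m).tsum_nonneg hx))

end Moments

section GammaRatio

open MeasureTheory ProbabilityTheory Set

variable {ι : Type*} [Fintype ι] {α β : ι → ℝ} {s : ℝ}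

/-- The exponential sum `∑ᵢ e^{-tᵢ s}`. Its pointwise comparison for two parameter vectors with the
same sum is what makes a ratio of rising factorials a multiplier of `NonnegOnNonpos`. -/
noncomputable def expSum (t : ι → ℝ) (s : ℝ) : ℝ := ∑ i, Real.exp (-(t i * s))

/-- The density whose moments against `e^{-ks}` are `∑ᵢ log (Γ(αᵢ + k) / Γ(βᵢ + k))` up to an
additive constant, when `∑ᵢ αᵢ = ∑ᵢ βᵢ`. -/
noncomputable def gammaKernel (α β : ι → ℝ) (s : ℝ) : ℝ :=
  (expSum α s - expSum β s) / (s * (1 - Real.exp (-s)))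

/-- The measure on `(0, ∞)` with density `gammaKernel α β`, for which `s ↦ e^{-s}` has the
logarithms of Gamma ratios as moments; the negative part of the density is discarded. -/
noncomputable def gammaMeasure (α β : ι → ℝ) : Measure ℝ :=
  (volume.restrict (Ioi 0)).withDensity fun s => ENNReal.ofReal (gammaKernel α β s)

theorem continuous_expSum (t : ι → ℝ) : Continuous (expSum t) := by
  unfold expSum
  fun_prop

theorem measurable_gammaKernel (α β : ι → ℝ) : Measurable (gammaKernel α β) :=
  ((continuous_expSum α).sub (continuous_expSum β)).measurable.div (by fun_prop)

theorem one_sub_exp_neg_pos (hs : 0 < s) : 0 < 1 - Real.exp (-s) :=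
  sub_pos.2 (Real.exp_lt_one_iff.2 (neg_neg_of_pos hs))

theorem gammaKernel_nonneg (hs : 0 < s) (h : expSum β s ≤ expSum α s) :
    0 ≤ gammaKernel α β s :=
  div_nonneg (sub_nonneg.2 h) (mul_pos hs (one_sub_exp_neg_pos hs)).le

theorem gammaKernel_pos (hs : 0 < s) (h : expSum β s < expSum α s) : 0 < gammaKernel α β s :=
  div_pos (sub_pos.2 h) (mul_pos hs (one_sub_exp_neg_pos hs))

theorem abs_exp_neg_sub_one_add_le {u : ℝ} (hu : 0 ≤ u) :
    |Real.exp (-u) - 1 + u| ≤ u ^ 2 / 2 := by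
  have hlower := Real.one_sub_le_exp_neg u
  have hupper : Real.exp (-u) ≤ 1 - u + u ^ 2 / 2 := by
    have hpos : 0 < 1 + u + u ^ 2 / 2 := by positivity
    rw [Real.exp_neg]
    calc (Real.exp u)⁻¹ ≤ (1 + u + u ^ 2 / 2)⁻¹ :=
          inv_anti₀ hpos (Real.quadratic_le_exp_of_nonneg hu)
      _ ≤ 1 - u + u ^ 2 / 2 := by
          rw [inv_le_iff_one_le_mul₀ hpos]
          linarith [pow_nonneg hu 4,
            show (1 - u + u ^ 2 / 2) * (1 + u + u ^ 2 / 2) = 1 + u ^ 4 / 4 by ring]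
  rw [abs_le]
  constructor <;> linarith [sq_nonneg u]

theorem abs_expSum_sub_le (hα : ∀ i, 0 < α i) (hβ : ∀ i, 0 < β i) (hsum : ∑ i, α i = ∑ i, β i)
    (hs : 0 ≤ s) : |expSum α s - expSum β s| ≤ (∑ i, (α i ^ 2 + β i ^ 2)) / 2 * s ^ 2 := by
  have hlin : ∑ i, α i * s = ∑ i, β i * s := by rw [← Finset.sum_mul, ← Finset.sum_mul, hsum]
  calc |expSum α s - expSum β s|
      = |∑ i, ((Real.exp (-(α i * s)) - 1 + α i * s) -
          (Real.exp (-(β i * s)) - 1 + β i * s))| := by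
        congr 1
        simp only [expSum, Finset.sum_sub_distrib, Finset.sum_add_distrib, hlin]
        ring
    _ ≤ ∑ i, ((α i * s) ^ 2 / 2 + (β i * s) ^ 2 / 2) :=
        (Finset.abs_sum_le_sum_abs _ _).trans <| Finset.sum_le_sum fun i _ =>
          (abs_sub _ _).trans <| add_le_add
            (abs_exp_neg_sub_one_add_le (mul_nonneg (hα i).le hs))
            (abs_exp_neg_sub_one_add_le (mul_nonneg (hβ i).le hs))
    _ = (∑ i, (α i ^ 2 + β i ^ 2)) / 2 * s ^ 2 := by
        rw [Finset.sum_div, Finset.sum_mul]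
        exact Finset.sum_congr rfl fun i _ => by ring

theorem abs_gammaKernel_le (hs : 0 < s) :
    |gammaKernel α β s| ≤ (1 + s) / s ^ 2 * |expSum α s - expSum β s| := by
  have hexp : s / (1 + s) ≤ 1 - Real.exp (-s) := by
    have hinv : Real.exp (-s) ≤ (1 + s)⁻¹ := by
      rw [Real.exp_neg]
      exact inv_anti₀ (by positivity) (by linarith [Real.add_one_le_exp s])
    rw [show s / (1 + s) = 1 - (1 + s)⁻¹ by field_simp; ring]
    linarith
  have hden : s ^ 2 / (1 + s) ≤ s * (1 - Real.exp (-s)) := by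
    rw [sq, mul_div_assoc]
    exact mul_le_mul_of_nonneg_left hexp hs.le
  rw [gammaKernel, abs_div, abs_of_pos (mul_pos hs (one_sub_exp_neg_pos hs)), div_eq_inv_mul,
    ← inv_div (s ^ 2)]
  exact mul_le_mul_of_nonneg_right (inv_anti₀ (by positivity) hden) (abs_nonneg _)

theorem integrableOn_exp_neg_mul {a : ℝ} (ha : 0 < a) :
    IntegrableOn (fun s => Real.exp (-(a * s))) (Ioi 0) := by
  simpa only [neg_mul] using exp_neg_integrableOn_Ioi 0 ha

theorem integrableOn_expSum {t : ι → ℝ} (ht : ∀ i, 0 < t i) : IntegrableOn (expSum t) (Ioi 0) :=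
  integrable_finsetSum _ fun i _ => integrableOn_exp_neg_mul (ht i)

theorem expSum_nonneg (t : ι → ℝ) (s : ℝ) : 0 ≤ expSum t s :=
  Finset.sum_nonneg fun _ _ => (Real.exp_pos _).le

theorem integrableOn_gammaKernel (hα : ∀ i, 0 < α i) (hβ : ∀ i, 0 < β i)
    (hsum : ∑ i, α i = ∑ i, β i) : IntegrableOn (gammaKernel α β) (Ioi 0) := by
  have hmeas := (measurable_gammaKernel α β).aestronglyMeasurable (μ := volume)
  rw [← Ioc_union_Ioi_eq_Ioi zero_le_one]
  refine IntegrableOn.union ?_ ?_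
  · refine Measure.integrableOn_of_bounded (M := ∑ i, (α i ^ 2 + β i ^ 2)) (by simp) hmeas ?_
    filter_upwards [ae_restrict_mem measurableSet_Ioc] with s hs
    have hs₀ : 0 < s := hs.1
    calc |gammaKernel α β s|
        ≤ (1 + s) / s ^ 2 * ((∑ i, (α i ^ 2 + β i ^ 2)) / 2 * s ^ 2) :=
          (abs_gammaKernel_le hs₀).trans
            (mul_le_mul_of_nonneg_left (abs_expSum_sub_le hα hβ hsum hs₀.le) (by positivity))
      _ = (1 + s) / 2 * ∑ i, (α i ^ 2 + β i ^ 2) := by field_simp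
      _ ≤ ∑ i, (α i ^ 2 + β i ^ 2) :=
          mul_le_of_le_one_left (by positivity) (by linarith [hs.2])
  · have hdom : IntegrableOn (fun s => 2 * (expSum α s + expSum β s)) (Ioi 0) :=
      ((integrableOn_expSum hα).add (integrableOn_expSum hβ)).const_mul 2
    refine (hdom.mono_set (Ioi_subset_Ioi zero_le_one)).mono' hmeas.restrict ?_
    filter_upwards [ae_restrict_mem measurableSet_Ioi] with s (hs : 1 < s)
    have hs₂ : (1 + s) / s ^ 2 ≤ 2 := by
      rw [div_le_iff₀ (by positivity)]
      nlinarith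
    calc |gammaKernel α β s| ≤ (1 + s) / s ^ 2 * |expSum α s - expSum β s| :=
          abs_gammaKernel_le (zero_lt_one.trans hs)
      _ ≤ 2 * (expSum α s + expSum β s) := by
          gcongr
          rw [abs_le]
          constructor <;> linarith [expSum_nonneg α s, expSum_nonneg β s]

theorem isFiniteMeasure_gammaMeasure (hα : ∀ i, 0 < α i) (hβ : ∀ i, 0 < β i)
    (hsum : ∑ i, α i = ∑ i, β i) : IsFiniteMeasure (gammaMeasure α β) :=
  isFiniteMeasure_withDensity_ofReal (integrableOn_gammaKernel hα hβ hsum).2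

theorem ae_gammaMeasure_exp_neg_mem_Icc (α β : ι → ℝ) :
    ∀ᵐ s ∂gammaMeasure α β, Real.exp (-s) ∈ Icc 0 1 := by
  refine (withDensity_absolutelyContinuous _ _).ae_le ?_
  filter_upwards [ae_restrict_mem measurableSet_Ioi] with s (hs : 0 < s)
  exact ⟨(Real.exp_pos _).le, Real.exp_le_one_iff.2 (neg_nonpos.2 hs.le)⟩

theorem gammaMeasure_exp_neg_mem_Ico_pos (h : ∀ s, 0 < s → expSum β s < expSum α s) {ε : ℝ}
    (hε : 0 < ε) : 0 < gammaMeasure α β {s | Real.exp (-s) ∈ Ico 0 ε} := by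
  have hac : volume.restrict (Ioi 0) ≪ gammaMeasure α β := by
    refine withDensity_absolutelyContinuous'
      (measurable_gammaKernel α β).ennreal_ofReal.aemeasurable ?_
    filter_upwards [ae_restrict_mem measurableSet_Ioi] with s (hs : 0 < s)
    exact (ENNReal.ofReal_pos.2 (gammaKernel_pos hs (h s hs))).ne'
  refine pos_iff_ne_zero.2 fun hzero => ?_
  have hsub : Ioi (max 0 (-Real.log ε)) ⊆ {s | Real.exp (-s) ∈ Ico 0 ε} ∩ Ioi 0 := by
    intro s hs
    obtain ⟨hs₀, hs₁⟩ := max_lt_iff.1 (mem_Ioi.1 hs)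
    exact ⟨⟨(Real.exp_pos _).le, (Real.lt_log_iff_exp_lt hε).1 (neg_lt.1 hs₁)⟩, hs₀⟩
  have hnull := hac hzero
  rw [Measure.restrict_apply' measurableSet_Ioi] at hnull
  simpa using measure_mono_null hsub hnull

theorem integrableOn_inv_mul_exp_sub_exp {a b : ℝ} (ha : 0 < a) (hb : 0 < b) :
    IntegrableOn (fun s => s⁻¹ * (Real.exp (-(a * s)) - Real.exp (-(b * s)))) (Ioi 0) := by
  wlog hab : a ≤ b generalizing a b
  · refine (this hb ha (le_of_not_ge hab)).neg.congr_fun (fun s _ => ?_) measurableSet_Ioi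
    rw [Pi.neg_apply, ← mul_neg, neg_sub]
  refine ((integrableOn_exp_neg_mul ha).const_mul (b - a)).mono'
    (Measurable.aestronglyMeasurable (by fun_prop)) ?_
  filter_upwards [ae_restrict_mem measurableSet_Ioi] with s (hs : 0 < s)
  have hle : Real.exp (-(b * s)) ≤ Real.exp (-(a * s)) := by gcongr
  have hfactor : Real.exp (-(b * s)) = Real.exp (-(a * s)) * Real.exp (-((b - a) * s)) := by
    rw [← Real.exp_add]
    ring_nf
  rw [Real.norm_of_nonneg (mul_nonneg (by positivity) (sub_nonneg.2 hle)), inv_mul_le_iff₀ hs,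
    hfactor]
  calc Real.exp (-(a * s)) - Real.exp (-(a * s)) * Real.exp (-((b - a) * s))
      = Real.exp (-(a * s)) * (1 - Real.exp (-((b - a) * s))) := by ring
    _ ≤ Real.exp (-(a * s)) * ((b - a) * s) := by
        gcongr
        linarith [Real.one_sub_le_exp_neg ((b - a) * s)]
    _ = s * ((b - a) * Real.exp (-(a * s))) := by ring

theorem integral_inv_mul_exp_sub_exp {a b : ℝ} (ha : 0 < a) (hb : 0 < b) :
    ∫ s in Ioi (0 : ℝ), s⁻¹ * (Real.exp (-(a * s)) - Real.exp (-(b * s))) = Real.log (b / a) := by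
  have hcont : Continuous fun u : ℝ => Real.exp (-u) := by fun_prop
  have h := Frullani.integral_Ioi_eq (f := fun u : ℝ => Real.exp (-u)) (L := 1) (R := 0)
    (hcont.locallyIntegrable.locallyIntegrableOn _) ha hb
    (by simpa using (hcont.tendsto 0).mono_left nhdsWithin_le_nhds)
    Real.tendsto_exp_neg_atTop_nhds_zero (integrableOn_inv_mul_exp_sub_exp ha hb)
  simpa using h

theorem gammaKernel_mul_exp_pow_sub (hs : 0 < s) (k : ℕ) :
    gammaKernel α β s * (Real.exp (-s) ^ k - Real.exp (-s) ^ (k + 1)) =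
      ∑ i, s⁻¹ * (Real.exp (-((α i + k) * s)) - Real.exp (-((β i + k) * s))) := by
  have he := (one_sub_exp_neg_pos hs).ne'
  have hsplit (a : ℝ) : Real.exp (-((a + k) * s)) = Real.exp (-(a * s)) * Real.exp (-s) ^ k := by
    rw [← Real.exp_nat_mul, ← Real.exp_add]
    ring_nf
  simp only [hsplit, ← sub_mul, ← Finset.mul_sum, ← Finset.sum_mul, Finset.sum_sub_distrib]
  rw [← expSum, ← expSum, gammaKernel, pow_succ]
  field_simp

theorem moment_gammaMeasure_sub_succ (hα : ∀ i, 0 < α i) (hβ : ∀ i, 0 < β i)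
    (hsum : ∑ i, α i = ∑ i, β i) (h : ∀ s, 0 < s → expSum β s ≤ expSum α s) (k : ℕ) :
    moment (fun s => Real.exp (-s)) k (gammaMeasure α β) -
        moment (fun s => Real.exp (-s)) (k + 1) (gammaMeasure α β) =
      ∑ i, Real.log ((β i + k) / (α i + k)) := by
  have hα' (i) : 0 < α i + k := add_pos_of_pos_of_nonneg (hα i) k.cast_nonneg
  have hβ' (i) : 0 < β i + k := add_pos_of_pos_of_nonneg (hβ i) k.cast_nonneg
  have := isFiniteMeasure_gammaMeasure hα hβ hsum
  have hint := integrable_pow_of_mem_Icc (T := fun s => Real.exp (-s)) (by fun_prop)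
    (ae_gammaMeasure_exp_neg_mem_Icc α β)
  calc _ = ∫ s, (Real.exp (-s) ^ k - Real.exp (-s) ^ (k + 1)) ∂gammaMeasure α β :=
        (integral_sub (hint k) (hint (k + 1))).symm
    _ = ∫ s in Ioi 0, ∑ i, s⁻¹ * (Real.exp (-((α i + k) * s)) - Real.exp (-((β i + k) * s))) := by
        rw [gammaMeasure, integral_withDensity_eq_integral_toReal_smul
          (measurable_gammaKernel α β).ennreal_ofReal (by simp)]
        refine setIntegral_congr_fun measurableSet_Ioi fun s (hs : 0 < s) => ?_
        rw [ENNReal.toReal_ofReal (gammaKernel_nonneg hs (h s hs)), smul_eq_mul,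
          gammaKernel_mul_exp_pow_sub hs]
    _ = ∑ i, Real.log ((β i + k) / (α i + k)) := by
        rw [integral_finsetSum _ fun i _ => integrableOn_inv_mul_exp_sub_exp (hα' i) (hβ' i)]
        exact Finset.sum_congr rfl fun i _ => integral_inv_mul_exp_sub_exp (hα' i) (hβ' i)

theorem prod_poch_div_poch (hα : ∀ i, 0 < α i) (hβ : ∀ i, 0 < β i)
    (hsum : ∑ i, α i = ∑ i, β i) (h : ∀ s, 0 < s → expSum β s ≤ expSum α s) (k : ℕ) :
    ∏ i, poch (α i) k / poch (β i) k =
      Real.exp (-moment (fun s => Real.exp (-s)) 0 (gammaMeasure α β)) *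
        Real.exp (moment (fun s => Real.exp (-s)) k (gammaMeasure α β)) := by
  induction k with
  | zero => simp [poch_zero, ← Real.exp_add]
  | succ k ih =>
    have hratio : ∏ i, (α i + k) / (β i + k) =
        Real.exp (-∑ i, Real.log ((β i + k) / (α i + k))) := by
      rw [← Finset.sum_neg_distrib, Real.exp_sum]
      refine Finset.prod_congr rfl fun i _ => ?_
      have hα' : 0 < α i + k := add_pos_of_pos_of_nonneg (hα i) k.cast_nonneg
      have hβ' : 0 < β i + k := add_pos_of_pos_of_nonneg (hβ i) k.cast_nonneg
      rw [Real.exp_neg, Real.exp_log (div_pos hβ' hα'), inv_div]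
    simp only [poch_succ, mul_div_mul_comm]
    rw [Finset.prod_mul_distrib, ih, hratio, ← moment_gammaMeasure_sub_succ hα hβ hsum h, mul_assoc,
      ← Real.exp_add, neg_sub, add_sub_cancel]

theorem NonnegOnNonpos.mul_prod_poch {f : ℕ → ℝ} (hf : NonnegOnNonpos f) (hα : ∀ i, 0 < α i)
    (hβ : ∀ i, 0 < β i) (hsum : ∑ i, α i = ∑ i, β i)
    (h : ∀ s, 0 < s → expSum β s ≤ expSum α s) :
    NonnegOnNonpos fun k => f k * ∏ i, poch (α i) k / poch (β i) k := by
  have := isFiniteMeasure_gammaMeasure hα hβ hsum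
  simp only [prod_poch_div_poch hα hβ hsum h, mul_left_comm (f _)]
  exact (hf.mul_exp_moment (by fun_prop) (ae_gammaMeasure_exp_neg_mem_Icc α β)).const_mul
    (Real.exp_pos _).le

theorem NonnegOnNonpos.tsum_mul_prod_poch_pos {f : ℕ → ℝ} (hf : NonnegOnNonpos f)
    (hf₀ : 0 < f 0) (hα : ∀ i, 0 < α i) (hβ : ∀ i, 0 < β i) (hsum : ∑ i, α i = ∑ i, β i)
    (h : ∀ s, 0 < s → expSum β s < expSum α s) {x : ℝ} (hx : x ≤ 0) :
    0 < ∑' k, f k * (∏ i, poch (α i) k / poch (β i) k) * x ^ k := by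
  have := isFiniteMeasure_gammaMeasure hα hβ hsum
  simp only [prod_poch_div_poch hα hβ hsum fun s hs => (h s hs).le, mul_left_comm (f _),
    mul_assoc (Real.exp _), tsum_mul_left]
  exact mul_pos (Real.exp_pos _) (hf.tsum_mul_exp_moment_pos hf₀ (by fun_prop)
    (ae_gammaMeasure_exp_neg_mem_Icc α β) (fun _ => gammaMeasure_exp_neg_mem_Ico_pos h) hx)

end GammaRatio

section TwoFThree

variable {a₁ a₂ c : ℝ} {b : Fin 3 → ℝ}

theorem Phi_eq_tsum (hc : 0 < c) (b : Fin 3 → ℝ) (x : ℝ) :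
    Phi a₁ a₂ b x = ∑' k, pFqCoeff [c] [c + 1 / 2, 2 * c] k *
      (∏ i, poch (![a₁, a₂, c + 1 / 2, 2 * c] i) k / poch (Matrix.vecCons c b i) k) *
        (-x ^ 2) ^ k := by
  rw [Phi, pFq_eq_tsum]
  refine tsum_congr fun k => ?_
  have h₁ := (poch_pos hc k).ne'
  have h₂ := (poch_pos (show 0 < c + 1 / 2 by positivity) k).ne'
  have h₃ := (poch_pos (show 0 < 2 * c by positivity) k).ne'
  have hprod : ∏ i, poch (![a₁, a₂, c + 1 / 2, 2 * c] i) k / poch (Matrix.vecCons c b i) k =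
      poch a₁ k / poch c k * (poch a₂ k / poch (b 0) k) * (poch (c + 1 / 2) k / poch (b 1) k) *
        (poch (2 * c) k / poch (b 2) k) := Fin.prod_univ_four _
  rw [hprod]
  simp only [pFqCoeff, List.map_cons, List.map_nil, List.prod_cons, List.prod_nil, mul_one]
  set d := c + 1 / 2
  field_simp

theorem vecCons_pos {n : ℕ} {t : Fin n → ℝ} (hc : 0 < c) (ht : ∀ k, 0 < t k) (i : Fin (n + 1)) :
    0 < Matrix.vecCons c t i :=
  Fin.cases hc ht i

theorem numerator_pos (ha₁ : 0 < a₁) (ha₂ : 0 < a₂) (hc : 0 < c) (i : Fin 4) :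
    0 < ![a₁, a₂, c + 1 / 2, 2 * c] i :=
  vecCons_pos ha₁ (vecCons_pos ha₂ (vecCons_pos (by positivity) (vecCons_pos (by positivity)
    Fin.rec0))) i

theorem sum_eq_sum_vecCons (hsum : ∑ k, b k = a₁ + a₂ + 1 / 2 + 2 * c) :
    ∑ i, ![a₁, a₂, c + 1 / 2, 2 * c] i = ∑ i, Matrix.vecCons c b i := by
  rw [Fin.sum_univ_succ (Matrix.vecCons c b)]
  simp only [Matrix.cons_val_zero, Matrix.cons_val_succ, hsum, Fin.sum_univ_four, Matrix.cons_val]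
  ring

theorem Phi_nonneg_of_expSum_le (ha₁ : 0 < a₁) (ha₂ : 0 < a₂) (hc : 0 < c) (hb : ∀ k, 0 < b k)
    (hsum : ∑ k, b k = a₁ + a₂ + 1 / 2 + 2 * c)
    (h : ∀ s, 0 < s →
      expSum (Matrix.vecCons c b) s ≤ expSum ![a₁, a₂, c + 1 / 2, 2 * c] s) (x : ℝ) :
    0 ≤ Phi a₁ a₂ b x := by
  rw [Phi_eq_tsum hc]
  exact ((nonnegOnNonpos_pFqCoeff_add_half hc).mul_prod_poch (numerator_pos ha₁ ha₂ hc)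
    (vecCons_pos hc hb) (sum_eq_sum_vecCons hsum) h).tsum_nonneg (neg_nonpos.2 (sq_nonneg x))

theorem Phi_pos_of_expSum_lt (ha₁ : 0 < a₁) (ha₂ : 0 < a₂) (hc : 0 < c) (hb : ∀ k, 0 < b k)
    (hsum : ∑ k, b k = a₁ + a₂ + 1 / 2 + 2 * c)
    (h : ∀ s, 0 < s →
      expSum (Matrix.vecCons c b) s < expSum ![a₁, a₂, c + 1 / 2, 2 * c] s) (x : ℝ) :
    0 < Phi a₁ a₂ b x := by
  rw [Phi_eq_tsum hc]
  exact (nonnegOnNonpos_pFqCoeff_add_half hc).tsum_mul_prod_poch_pos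
    (by simp [pFqCoeff, poch_zero]) (numerator_pos ha₁ ha₂ hc) (vecCons_pos hc hb)
    (sum_eq_sum_vecCons hsum) h (neg_nonpos.2 (sq_nonneg x))

end TwoFThree

section Convexity

open Set

theorem strictConvexOn_exp_neg_mul {s : ℝ} (hs : 0 < s) :
    StrictConvexOn ℝ univ fun u => Real.exp (-(u * s)) := by
  refine ⟨convex_univ, fun p _ q _ hpq w z hw hz hwz => ?_⟩
  have hne : -(p * s) ≠ -(q * s) := fun h => hpq (mul_right_cancel₀ hs.ne' (neg_injective h))
  have h := strictConvexOn_exp.2 (mem_univ _) (mem_univ _) hne hw hz hwz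
  simp only [smul_eq_mul] at h ⊢
  rwa [show -((w * p + z * q) * s) = w * -(p * s) + z * -(q * s) by ring]

theorem strictConvexOn_expSum {ι : Type*} [Fintype ι] {s : ℝ} (hs : 0 < s) :
    StrictConvexOn ℝ univ fun t : ι → ℝ => expSum t s := by
  refine ⟨convex_univ, fun p _ q _ hpq w z hw hz hwz => ?_⟩
  obtain ⟨i, hi⟩ := Function.ne_iff.1 hpq
  have hexp := strictConvexOn_exp_neg_mul hs
  simp only [expSum, Finset.smul_sum, ← Finset.sum_add_distrib]
  exact Finset.sum_lt_sum (fun k _ => hexp.convexOn.2 (mem_univ _) (mem_univ _) hw.le hz.le hwz)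
    ⟨i, Finset.mem_univ i, hexp.2 (mem_univ _) (mem_univ _) hi hw hz hwz⟩

variable {φ : ℝ → ℝ} {p q h t : ℝ}

theorem map_mix_add_map_mix_lt (hφ : StrictConvexOn ℝ univ φ) (hpq : p ≠ q) (ht₀ : 0 < t)
    (ht₁ : t < 1) : φ ((1 - t) * p + t * q) + φ (t * p + (1 - t) * q) < φ p + φ q := by
  have h₁ := hφ.2 (mem_univ p) (mem_univ q) hpq (sub_pos.2 ht₁) ht₀ (sub_add_cancel 1 t)
  have h₂ := hφ.2 (mem_univ p) (mem_univ q) hpq ht₀ (sub_pos.2 ht₁) (add_sub_cancel t 1)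
  simp only [smul_eq_mul] at h₁ h₂
  linarith

theorem map_mix_add_map_shift_lt (hφ : StrictConvexOn ℝ univ φ)
    (hsub : ConvexOn ℝ univ fun u => φ u - φ (u + h)) (hh : h ≠ 0) (ht₀ : 0 < t) (ht₁ : t < 1) :
    φ ((1 - t) * p + t * q) + φ (p + (1 - t) * h) + φ (q + t * h) <
      φ p + φ q + φ ((1 - t) * p + t * q + h) := by
  have hmix := hsub.2 (mem_univ p) (mem_univ q) (sub_pos.2 ht₁).le ht₀.le (sub_add_cancel 1 t)
  have hp := hφ.2 (mem_univ p) (mem_univ (p + h)) (by simpa using hh) ht₀ (sub_pos.2 ht₁)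
    (add_sub_cancel t 1)
  have hq := hφ.2 (mem_univ q) (mem_univ (q + h)) (by simpa using hh) (sub_pos.2 ht₁) ht₀
    (sub_add_cancel 1 t)
  simp only [smul_eq_mul] at hmix hp hq
  rw [show t * p + (1 - t) * (p + h) = p + (1 - t) * h by ring] at hp
  rw [show (1 - t) * q + t * (q + h) = q + t * h by ring] at hq
  linarith

theorem convexOn_exp_neg_mul_sub_shift {s : ℝ} (hs : 0 < s) (hh : 0 ≤ h) :
    ConvexOn ℝ univ fun u => Real.exp (-(u * s)) - Real.exp (-((u + h) * s)) := by
  have hfactor (u : ℝ) : Real.exp (-(u * s)) - Real.exp (-((u + h) * s)) =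
      (1 - Real.exp (-(h * s))) • Real.exp (-(u * s)) := by
    rw [add_mul, neg_add, Real.exp_add, smul_eq_mul]
    ring
  simp only [hfactor]
  exact (strictConvexOn_exp_neg_mul hs).convexOn.smul
    (sub_nonneg.2 (Real.exp_le_one_iff.2 (neg_nonpos.2 (by positivity))))

end Convexity

section Permutations

open Set

variable {t b : Fin 3 → ℝ} {i j : Label} {s : ℝ}

theorem exists_permuted_eq_comp (i : Label) :
    ∃ σ : Equiv.Perm (Fin 3), ∀ t, permuted t i = t ∘ σ := by
  suffices h : ∃ σ : Equiv.Perm (Fin 3), ∀ t, permuted t i = ![t (σ 0), t (σ 1), t (σ 2)] by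
    obtain ⟨σ, hσ⟩ := h
    exact ⟨σ, fun t => (hσ t).trans (by ext k; fin_cases k <;> rfl)⟩
  cases i
  exacts [⟨1, fun _ => rfl⟩, ⟨Equiv.swap 0 1, fun _ => rfl⟩, ⟨Equiv.swap 1 2, fun _ => rfl⟩,
    ⟨(finRotate 3).symm, fun _ => rfl⟩, ⟨finRotate 3, fun _ => rfl⟩, ⟨Equiv.swap 0 2, fun _ => rfl⟩]

theorem permuted_smul_add_smul (w z : ℝ) (t u : Fin 3 → ℝ) (i : Label) :
    w • permuted t i + z • permuted u i = permuted (w • t + z • u) i := by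
  obtain ⟨σ, hσ⟩ := exists_permuted_eq_comp i
  simp only [hσ]
  rfl

theorem sum_permuted (φ : ℝ → ℝ) (t : Fin 3 → ℝ) (i : Label) :
    ∑ k, φ (permuted t i k) = ∑ k, φ (t k) := by
  obtain ⟨σ, hσ⟩ := exists_permuted_eq_comp i
  simp only [hσ, Function.comp_apply]
  exact Equiv.sum_comp σ fun k => φ (t k)

theorem expSum_permuted (t : Fin 3 → ℝ) (i : Label) (s : ℝ) :
    expSum (permuted t i) s = expSum t s :=
  sum_permuted (fun u => Real.exp (-(u * s))) t i

theorem pos_of_mem_segment_permuted (ht : ∀ k, 0 < t k)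
    (hb : b ∈ segment ℝ (permuted t i) (permuted t j)) (k : Fin 3) : 0 < b k := by
  have hpermuted (l : Label) : permuted t l ∈ {u : Fin 3 → ℝ | 0 < u k} := by
    obtain ⟨σ, hσ⟩ := exists_permuted_eq_comp l
    rw [hσ]
    exact ht (σ k)
  exact (convex_halfSpace_gt (LinearMap.proj k).isLinear 0).segment_subset (hpermuted i)
    (hpermuted j) hb

theorem sum_eq_of_mem_segment_permuted (hb : b ∈ segment ℝ (permuted t i) (permuted t j)) :
    ∑ k, b k = ∑ k, t k := by
  obtain ⟨w, z, -, -, hwz, rfl⟩ := hb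
  simp only [Pi.add_apply, Pi.smul_apply, smul_eq_mul, Finset.sum_add_distrib, ← Finset.mul_sum]
  rw [sum_permuted (fun u => u), sum_permuted (fun u => u), ← add_mul, hwz, one_mul]

theorem expSum_le_of_mem_segment_permuted (hs : 0 < s)
    (hb : b ∈ segment ℝ (permuted t i) (permuted t j)) : expSum b s ≤ expSum t s := by
  simpa only [expSum_permuted, max_self] using
    (strictConvexOn_expSum hs).convexOn.le_on_segment (mem_univ _) (mem_univ _) hb

theorem expSum_lt_of_mem_segment_permuted (hs : 0 < s)
    (hb : b ∈ segment ℝ (permuted t i) (permuted t j)) (hi : b ≠ permuted t i)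
    (hj : b ≠ permuted t j) : expSum b s < expSum t s := by
  have hne : permuted t i ≠ permuted t j := by
    intro heq
    rw [← heq, segment_same] at hb
    exact hi hb
  simpa only [expSum_permuted, max_self] using
    (strictConvexOn_expSum hs).lt_on_openSegment (mem_univ _) (mem_univ _) hne
      (mem_openSegment_of_ne_left_right hi.symm hj.symm hb)

end Permutations

section SideQuadrilaterals

open Set

theorem ascending_swap_left (p q r : ℝ) : ascending p q r = ascending q p r := by
  rw [ascending, ascending, min_left_comm, max_left_comm, add_comm p q]

theorem ascending_swap_right (p q r : ℝ) : ascending p q r = ascending p r q := by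
  rw [ascending, ascending, min_comm q, max_comm q, add_right_comm]

theorem ascending_of_le {p q r : ℝ} (hpq : p ≤ q) (hqr : q ≤ r) :
    ascending p q r = ![p, q, r] := by
  rw [ascending, min_eq_left hqr, max_eq_right hqr, min_eq_left hpq,
    max_eq_right (hpq.trans hqr)]
  ring_nf

theorem ascending_pos {p q r : ℝ} (hp : 0 < p) (hq : 0 < q) (hr : 0 < r) (k : Fin 3) :
    0 < ascending p q r k :=
  (lt_min hp (lt_min hq hr)).trans_le (ascending_mono p q r (Fin.zero_le k))

variable {a₁ a₂ lam : ℝ} {b : Fin 3 → ℝ} {i j : Label} {s : ℝ}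

theorem fst_lt_snd_of_admissible (ha : (a₁, a₂) ∈ admissible) : a₁ < a₂ := by
  obtain ⟨-, -, hlt, hge⟩ := ha
  exact (lt_or_ge a₁ (1 / 2)).elim (fun h => (hlt h).1) fun h => (hge h).1

theorem xi_eta_cases (ha : (a₁, a₂) ∈ admissible) :
    (xi a₁ a₂ = ![a₂, 2 * a₁, a₁ + 1 / 2] ∧ eta a₁ a₂ = ![a₁, 2 * a₂, a₂ + 1 / 2]) ∨
    (xi a₁ a₂ = ![a₂, a₁ + 1 / 2, 2 * a₁] ∧ eta a₁ a₂ = ![a₁, a₂ + 1 / 2, 2 * a₂]) ∨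
    (xi a₁ a₂ = ![a₁ + 1 / 2, a₂, 2 * a₁] ∧ eta a₁ a₂ = ![a₁, a₂ + 1 / 2, 2 * a₂]) := by
  obtain ⟨ha₁, -, hlt, hge⟩ : 0 < a₁ ∧ _ := ha
  rcases lt_or_ge a₁ (1 / 2) with h | h
  · obtain ⟨hlt, hle⟩ : a₁ < a₂ ∧ a₂ ≤ min (2 * a₁) (1 / 2) := hlt h
    obtain ⟨hle₁, hle₂⟩ : a₂ ≤ 2 * a₁ ∧ a₂ ≤ 1 / 2 := le_min_iff.1 hle
    refine Or.inl ⟨?_, ?_⟩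
    · rw [xi, ascending_swap_right, ascending_of_le] <;> linarith
    · rw [eta, ascending_swap_right, ascending_of_le] <;> linarith
  · obtain ⟨hlt, hle⟩ : a₁ < a₂ ∧ a₂ ≤ 2 * a₁ := hge h
    have heta : eta a₁ a₂ = ![a₁, a₂ + 1 / 2, 2 * a₂] := by
      rw [eta, ascending_of_le] <;> linarith
    refine Or.inr ?_
    rcases le_total a₂ (a₁ + 1 / 2) with h' | h'
    · refine Or.inl ⟨?_, heta⟩
      rw [xi, ascending_of_le] <;> linarith
    · refine Or.inr ⟨?_, heta⟩
      rw [xi, ascending_swap_left, ascending_of_le] <;> linarith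

/-- The point `(1 - lam) ξ + lam η` of the segment `[ξ, η]`. Its permutations are the end points of
the segments that make up the side quadrilaterals. -/
noncomputable def between (a₁ a₂ lam : ℝ) : Fin 3 → ℝ := (1 - lam) • xi a₁ a₂ + lam • eta a₁ a₂

theorem permuted_between_zero (a₁ a₂ : ℝ) (i : Label) :
    permuted (between a₁ a₂ 0) i = A a₁ a₂ i := by
  rw [between, sub_zero, one_smul, zero_smul, add_zero, A]

theorem permuted_between_one (a₁ a₂ : ℝ) (i : Label) :
    permuted (between a₁ a₂ 1) i = B a₁ a₂ i := by
  rw [between, sub_self, one_smul, zero_smul, zero_add, B]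

theorem mem_S_iff : b ∈ S a₁ a₂ i j ↔ ∃ lam ∈ Icc (0 : ℝ) 1,
    b ∈ segment ℝ (permuted (between a₁ a₂ lam) i) (permuted (between a₁ a₂ lam) j) := by
  simp only [S, A, B, permuted_smul_add_smul, mem_iUnion₂, exists_prop, between]

theorem between_pos (ha₁ : 0 < a₁) (ha₂ : 0 < a₂) (hlam : lam ∈ Icc (0 : ℝ) 1) (k : Fin 3) :
    0 < between a₁ a₂ lam k :=
  convex_Ioi (𝕜 := ℝ) (0 : ℝ) (ascending_pos ha₂ (by positivity) (by positivity) k)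
    (ascending_pos ha₁ (by positivity) (by positivity) k) (sub_nonneg.2 hlam.2) hlam.1
    (sub_add_cancel 1 lam)

theorem sum_between_cases (ha : (a₁, a₂) ∈ admissible) (lam : ℝ) (φ : ℝ → ℝ) :
    (∑ k, φ (between a₁ a₂ lam k) = φ (lam * a₁ + (1 - lam) * a₂) +
      φ ((1 - lam) * a₁ + lam * a₂ + 1 / 2) + φ (2 * ((1 - lam) * a₁ + lam * a₂))) ∨
    (∑ k, φ (between a₁ a₂ lam k) = φ (a₁ + (1 - lam) * (1 / 2)) + φ (a₂ + lam * (1 / 2)) +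
      φ (2 * ((1 - lam) * a₁ + lam * a₂))) := by
  simp only [between, Fin.sum_univ_three, Pi.add_apply, Pi.smul_apply, smul_eq_mul]
  rcases xi_eta_cases ha with ⟨hxi, heta⟩ | ⟨hxi, heta⟩ | ⟨hxi, heta⟩ <;>
    simp only [hxi, heta, Matrix.cons_val]
  · left
    rw [add_right_comm]
    ring_nf
  · left
    ring_nf
  · right
    ring_nf

theorem sum_between (ha : (a₁, a₂) ∈ admissible) (lam : ℝ) :
    ∑ k, between a₁ a₂ lam k = a₁ + a₂ + 1 / 2 + 2 * ((1 - lam) * a₁ + lam * a₂) := by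
  rcases sum_between_cases ha lam fun u => u with h | h <;> rw [h] <;> ring

theorem expSum_vecCons {n : ℕ} (c : ℝ) (t : Fin n → ℝ) (s : ℝ) :
    expSum (Matrix.vecCons c t) s = Real.exp (-(c * s)) + expSum t s := by
  simp only [expSum, Fin.sum_univ_succ, Matrix.cons_val_zero, Matrix.cons_val_succ]

theorem expSum_vecCons_between_lt (ha : (a₁, a₂) ∈ admissible) (hlam : lam ∈ Ioo (0 : ℝ) 1)
    (hs : 0 < s) :
    expSum (Matrix.vecCons ((1 - lam) * a₁ + lam * a₂) (between a₁ a₂ lam)) s <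
      expSum ![a₁, a₂, (1 - lam) * a₁ + lam * a₂ + 1 / 2, 2 * ((1 - lam) * a₁ + lam * a₂)] s := by
  have hφ := strictConvexOn_exp_neg_mul hs
  rw [expSum_vecCons]
  simp only [expSum, Fin.sum_univ_four, Matrix.cons_val]
  rcases sum_between_cases ha lam fun u => Real.exp (-(u * s)) with h | h <;> rw [h]
  · linarith [map_mix_add_map_mix_lt hφ (fst_lt_snd_of_admissible ha).ne hlam.1 hlam.2]
  · have hsub := convexOn_exp_neg_mul_sub_shift hs one_half_pos.le
    linarith [map_mix_add_map_shift_lt (p := a₁) (q := a₂) hφ hsub one_half_pos.ne' hlam.1 hlam.2]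

theorem expSum_vecCons_between_le (ha : (a₁, a₂) ∈ admissible) (hlam : lam ∈ Icc (0 : ℝ) 1)
    (hs : 0 < s) :
    expSum (Matrix.vecCons ((1 - lam) * a₁ + lam * a₂) (between a₁ a₂ lam)) s ≤
      expSum ![a₁, a₂, (1 - lam) * a₁ + lam * a₂ + 1 / 2, 2 * ((1 - lam) * a₁ + lam * a₂)] s := by
  rcases eq_endpoints_or_mem_Ioo_of_mem_Icc hlam with hlam | hlam | hlam
  case inr.inr => exact (expSum_vecCons_between_lt ha hlam hs).le
  all_goals
    rw [expSum_vecCons]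
    simp only [expSum, Fin.sum_univ_four, Matrix.cons_val]
    apply le_of_eq
    rcases sum_between_cases ha lam fun u => Real.exp (-(u * s)) with h | h <;> rw [h, hlam] <;>
      ring_nf

theorem expSum_vecCons_le_of_mem_segment (ha : (a₁, a₂) ∈ admissible)
    (hlam : lam ∈ Icc (0 : ℝ) 1)
    (hb : b ∈ segment ℝ (permuted (between a₁ a₂ lam) i) (permuted (between a₁ a₂ lam) j))
    (hs : 0 < s) :
    expSum (Matrix.vecCons ((1 - lam) * a₁ + lam * a₂) b) s ≤
      expSum ![a₁, a₂, (1 - lam) * a₁ + lam * a₂ + 1 / 2, 2 * ((1 - lam) * a₁ + lam * a₂)] s := by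
  refine le_trans ?_ (expSum_vecCons_between_le ha hlam hs)
  simpa only [expSum_vecCons, add_le_add_iff_left] using expSum_le_of_mem_segment_permuted hs hb

theorem expSum_vecCons_lt_of_mem_segment (ha : (a₁, a₂) ∈ admissible)
    (hlam : lam ∈ Icc (0 : ℝ) 1)
    (hb : b ∈ segment ℝ (permuted (between a₁ a₂ lam) i) (permuted (between a₁ a₂ lam) j))
    (hvertices : b ∉ ({A a₁ a₂ i, A a₁ a₂ j, B a₁ a₂ j, B a₁ a₂ i} : Set (Fin 3 → ℝ)))
    (hs : 0 < s) :
    expSum (Matrix.vecCons ((1 - lam) * a₁ + lam * a₂) b) s <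
      expSum ![a₁, a₂, (1 - lam) * a₁ + lam * a₂ + 1 / 2, 2 * ((1 - lam) * a₁ + lam * a₂)] s := by
  simp only [mem_insert_iff, mem_singleton_iff, not_or] at hvertices
  obtain ⟨hAi, hAj, hBj, hBi⟩ := hvertices
  have hedge (hi : b ≠ permuted (between a₁ a₂ lam) i) (hj : b ≠ permuted (between a₁ a₂ lam) j) :
      expSum (Matrix.vecCons ((1 - lam) * a₁ + lam * a₂) b) s <
        expSum ![a₁, a₂, (1 - lam) * a₁ + lam * a₂ + 1 / 2, 2 * ((1 - lam) * a₁ + lam * a₂)] s := by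
    refine lt_of_lt_of_le ?_ (expSum_vecCons_between_le ha hlam hs)
    simpa only [expSum_vecCons, add_lt_add_iff_left] using
      expSum_lt_of_mem_segment_permuted hs hb hi hj
  rcases eq_endpoints_or_mem_Ioo_of_mem_Icc hlam with rfl | rfl | hinterior
  · exact hedge (by rwa [permuted_between_zero]) (by rwa [permuted_between_zero])
  · exact hedge (by rwa [permuted_between_one]) (by rwa [permuted_between_one])
  · refine lt_of_le_of_lt ?_ (expSum_vecCons_between_lt ha hinterior hs)
    simpa only [expSum_vecCons, add_le_add_iff_left] using expSum_le_of_mem_segment_permuted hs hb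

end SideQuadrilaterals

end SideQuad

theorem proposition4_general (a₁ a₂ : ℝ) (ha : (a₁, a₂) ∈ SideQuad.admissible)
    (i j : SideQuad.Label) (b : Fin 3 → ℝ) (hb : b ∈ SideQuad.S a₁ a₂ i j) :
    (∀ x : ℝ, 0 ≤ SideQuad.Phi a₁ a₂ b x) ∧
      (b ∉ ({SideQuad.A a₁ a₂ i, SideQuad.A a₁ a₂ j, SideQuad.B a₁ a₂ j,
          SideQuad.B a₁ a₂ i} : Set (Fin 3 → ℝ)) →
        ∀ x : ℝ, 0 < SideQuad.Phi a₁ a₂ b x) := by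
  obtain ⟨lam, hlam, hseg⟩ := SideQuad.mem_S_iff.1 hb
  have ha₁ : 0 < a₁ := ha.1
  have ha₂ : 0 < a₂ := ha.2.1
  have hc : 0 < (1 - lam) * a₁ + lam * a₂ :=
    convex_Ioi (0 : ℝ) ha₁ ha₂ (sub_nonneg.2 hlam.2) hlam.1 (sub_add_cancel 1 lam)
  have hpos := SideQuad.pos_of_mem_segment_permuted (SideQuad.between_pos ha₁ ha₂ hlam) hseg
  have hsum := (SideQuad.sum_eq_of_mem_segment_permuted hseg).trans (SideQuad.sum_between ha lam)
  refine ⟨?_, fun hvertices => ?_⟩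
  · exact SideQuad.Phi_nonneg_of_expSum_le ha₁ ha₂ hc hpos hsum fun _ =>
      SideQuad.expSum_vecCons_le_of_mem_segment ha hlam hseg
  · exact SideQuad.Phi_pos_of_expSum_lt ha₁ ha₂ hc hpos hsum fun _ =>
      SideQuad.expSum_vecCons_lt_of_mem_segment ha hlam hseg hvertices

theorem proposition4 (a₁ a₂ : ℝ) (ha : (a₁, a₂) ∈ SideQuad.admissible)
    (i j : SideQuad.Label)
    (hij : (i = .five ∧ j = .six) ∨ (i = .one ∧ j = .three) ∨ (i = .two ∧ j = .four))
    (b : Fin 3 → ℝ) (hb : b ∈ SideQuad.S a₁ a₂ i j) :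
    (∀ x : ℝ, 0 < x → 0 ≤ SideQuad.Phi a₁ a₂ b x) ∧
      (b ∉ ({SideQuad.A a₁ a₂ i, SideQuad.A a₁ a₂ j, SideQuad.B a₁ a₂ j,
          SideQuad.B a₁ a₂ i} : Set (Fin 3 → ℝ)) →
        ∀ x : ℝ, 0 < x → 0 < SideQuad.Phi a₁ a₂ b x) :=
  have h := proposition4_general a₁ a₂ ha i j b hb
  ⟨fun x _ => h.1 x, fun hvertices x _ => h.2 hvertices x⟩
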